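/- Let $Q:\mathbb R^n\to\mathbb R^{\ell}$ be continuously differentiable, $Z(x)=\begin{bmatrix}x\\Q(x)\end{bmatrix}\in\mathbb R^{s}$ with $s=n+\ell$, and consider the system $$\dot x=f(x)+Bu+Ed,\qquad y=h(x),\qquad e=y-r,$$ with state $x\in\mathbb R^n$, input $u\in\mathbb R^m$, output $y\in\mathbb R^p$, constant disturbance $d\in\mathbb R^q$ and constant reference $r\in\mathbb R^p$, where $f(x)=AZ(x)$ and $h(x)=CZ(x)$ for some matrices $A\in\mathbb R^{n\times s}$, $C\in\mathbb R^{p\times s}$. Let $R_Q\in\mathbb R^{n\times\tau}$ be such that $\frac{\partial Q}{\partial x}(x)^\top\frac{\partial Q}{\partial x}(x)\preceq R_QR_Q^\top$ for all $x\in\mathbb R^n$, and put $\mathcal R_Q=\begin{bmatrix}R_Q\\0_{p\times\tau}\end{bmatrix}$, $\mathcal Z(x,\xi)=\begin{bmatrix}x\\ \xi\\ Q(x)\end{bmatrix}$ for $\xi\in\mathbb R^p$. In an experiment on this system together with $\dot\xi=e$, carried out under some constant disturbance $d_{\rm e}$ and some constant reference $r_{\rm e}$, samples are taken at times $0\le t_0<\dots<t_{T-1}$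 and collected in the matrices $$U_0=\begin{bmatrix}u(t_0)&\cdots&u(t_{T-1})\end{bmatrix},\quad \mathcal Z_0=\begin{bmatrix}\mathcal Z(x(t_0),\xi(t_0))&\cdots&\mathcal Z(x(t_{T-1}),\xi(t_{T-1}))\end{bmatrix},\quad \mathcal Z_1=\begin{bmatrix}\dot x(t_0)&\cdots&\dot x(t_{T-1})\\ y(t_0)&\cdots&y(t_{T-1})\end{bmatrix}.$$ Suppose that the symmetric matrix $\mathcal P\in\mathbb R^{(n+p)\times(n+p)}$, $\mathcal Y_1\in\mathbb R^{T\times(n+p)}$, $\mathcal G_2\in\mathbb R^{T\times\ell}$ and $\alpha>0$ satisfy $\mathcal P\succ0$ and $$\mathcal Z_0\mathcal Y_1=\begin{bmatrix}\mathcal P\\0_{\ell\times(n+p)}\end{bmatrix},\quad \mathcal Z_0\mathcal G_2=\begin{bmatrix}0_{(n+p)\times\ell}\\I_\ell\end{bmatrix},\quad \begin{bmatrix}1&\cdots&1\end{bmatrix}\begin{bmatrix}\mathcal Y_1&\mathcal G_2\end{bmatrix}=0,$$ $$\begin{bmatrix}\mathcal Z_1\mathcal Y_1+(\mathcal Z_1\mathcal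 Y_1)^\top+\alpha I_{n+p}&\mathcal Z_1\mathcal G_2&\mathcal P\mathcal R_Q\\ \mathcal G_2^\top\mathcal Z_1^\top&-I_\ell&0\\ \mathcal R_Q^\top\mathcal P&0&-I_\tau\end{bmatrix}\preceq0,$$ and put $\mathcal K=U_0\begin{bmatrix}\mathcal Y_1\mathcal P^{-1}&\mathcal G_2\end{bmatrix}$. Then for every constant disturbance $d\in\mathbb R^q$ and every constant reference $r\in\mathbb R^p$ the closed-loop system $$\dot x=f(x)+B\mathcal K\mathcal Z(x,\xi)+Ed,\qquad \dot\xi=e,\qquad e=h(x)-r$$ has, from every initial condition in $\mathbb R^n\times\mathbb R^p$, a unique solution, which is defined for all $t\ge0$; every such solution $(x(t),\xi(t))$ is bounded on $[0,\infty)$, and $e(t)\to0$ as $t\to+\infty$. -/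

import Mathlib

open Set Filter Topology Matrix

noncomputable section

namespace IntegralControl

variable {n p m q ℓ τ T : ℕ}

/-- The Jacobian matrix `∂Q/∂x` at the point `x`. -/
def jacobian (Q : (Fin n → ℝ) → (Fin ℓ → ℝ)) (x : Fin n → ℝ) : Matrix (Fin ℓ) (Fin n) ℝ :=
  LinearMap.toMatrix' (fderiv ℝ Q x : (Fin n → ℝ) →ₗ[ℝ] (Fin ℓ → ℝ))

/-- The dictionary `Z(x) = [x; Q(x)]`, with `s = n + ℓ` entries. -/
def dictionary (Q : (Fin n → ℝ) → (Fin ℓ → ℝ)) (x : Fin n → ℝ) : Fin n ⊕ Fin ℓ → ℝ :=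
  Sum.elim x (Q x)

/-- The extended dictionary `𝒵(x, ξ) = [x; ξ; Q(x)]`. -/
def extDictionary (Q : (Fin n → ℝ) → (Fin ℓ → ℝ)) (x : Fin n → ℝ) (ξ : Fin p → ℝ) :
    (Fin n ⊕ Fin p) ⊕ Fin ℓ → ℝ :=
  Sum.elim (Sum.elim x ξ) (Q x)

/-- The signals `x, ξ, u, y` (functions of time `≥ 0`), sampled at the distinct times
`0 ≤ t 0 < t 1 < ⋯ < t (T - 1)`, come from an experiment on the system
`ẋ = f(x) + B u + E d`, `y = h(x)`, `ξ̇ = y - r` with constant `d` and `r`.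
The equations are only required at the sampling times, so that the input may be
discontinuous at other times. -/
structure IsExperiment (f : (Fin n → ℝ) → (Fin n → ℝ)) (h : (Fin n → ℝ) → (Fin p → ℝ))
    (B : Matrix (Fin n) (Fin m) ℝ) (E : Matrix (Fin n) (Fin q) ℝ)
    (d : Fin q → ℝ) (r : Fin p → ℝ) (t : Fin T → ℝ)
    (x : ℝ → (Fin n → ℝ)) (ξ : ℝ → (Fin p → ℝ))
    (u : ℝ → (Fin m → ℝ)) (y : ℝ → (Fin p → ℝ)) : Prop where
  times_nonneg : ∀ i, 0 ≤ t i
  times_strictMono : StrictMono t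
  state_eq : ∀ i, HasDerivWithinAt x (f (x (t i)) + B *ᵥ u (t i) + E *ᵥ d) (Ici 0) (t i)
  output_eq : ∀ i, y (t i) = h (x (t i))
  integrator_eq : ∀ i, HasDerivWithinAt ξ (y (t i) - r) (Ici 0) (t i)

/-- The data matrix `U₀`, with columns `u(tᵢ)`. -/
def dataU0 (t : Fin T → ℝ) (u : ℝ → (Fin m → ℝ)) : Matrix (Fin m) (Fin T) ℝ :=
  Matrix.of fun j i => u (t i) j

/-- The data matrix `𝒵₀`, with columns `[x(tᵢ); ξ(tᵢ); Q(x(tᵢ))]`. -/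
def dataZ0 (Q : (Fin n → ℝ) → (Fin ℓ → ℝ)) (t : Fin T → ℝ)
    (x : ℝ → (Fin n → ℝ)) (ξ : ℝ → (Fin p → ℝ)) :
    Matrix ((Fin n ⊕ Fin p) ⊕ Fin ℓ) (Fin T) ℝ :=
  Matrix.of fun j i => extDictionary Q (x (t i)) (ξ (t i)) j

/-- The data matrix `𝒵₁`, with columns `[ẋ(tᵢ); y(tᵢ)]`. -/
def dataZ1 (t : Fin T → ℝ) (x : ℝ → (Fin n → ℝ)) (y : ℝ → (Fin p → ℝ)) :
    Matrix (Fin n ⊕ Fin p) (Fin T) ℝ :=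
  Matrix.of fun j i => Sum.elim (derivWithin x (Ici 0) (t i)) (y (t i)) j

/-- `(P, Y₁, G₂, α)` is a feasible point of the semidefinite program given by the data
matrices `𝒵₀`, `𝒵₁` and the matrix `R_Q`. In Mathlib, positive (semi)definiteness includes
symmetry of a real matrix. -/
structure SDPFeasible (Z0 : Matrix ((Fin n ⊕ Fin p) ⊕ Fin ℓ) (Fin T) ℝ)
    (Z1 : Matrix (Fin n ⊕ Fin p) (Fin T) ℝ) (RQ : Matrix (Fin n) (Fin τ) ℝ)
    (P : Matrix (Fin n ⊕ Fin p) (Fin n ⊕ Fin p) ℝ)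
    (Y1 : Matrix (Fin T) (Fin n ⊕ Fin p) ℝ) (G2 : Matrix (Fin T) (Fin ℓ) ℝ) (α : ℝ) :
    Prop where
  alpha_pos : 0 < α
  posDef : P.PosDef
  data_Y1 : Z0 * Y1 = fromRows P 0
  lmi : (-(fromBlocks
      (fromBlocks (Z1 * Y1 + (Z1 * Y1)ᵀ + α • 1) (Z1 * G2) (G2ᵀ * Z1ᵀ) (-1))
      (fromRows (P * fromRows RQ 0) 0)
      (fromCols ((fromRows RQ 0)ᵀ * P) 0)
      (-1 : Matrix (Fin τ) (Fin τ) ℝ))).PosSemidef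
  data_G2 : Z0 * G2 = fromRows 0 1
  ones : (Matrix.of fun _ _ => 1 : Matrix (Fin 1) (Fin T) ℝ) * fromCols Y1 G2 = 0

/-- The controller gain `𝒦 = U₀ [Y₁ P⁻¹, G₂]`. -/
def gain (U0 : Matrix (Fin m) (Fin T) ℝ) (P : Matrix (Fin n ⊕ Fin p) (Fin n ⊕ Fin p) ℝ)
    (Y1 : Matrix (Fin T) (Fin n ⊕ Fin p) ℝ) (G2 : Matrix (Fin T) (Fin ℓ) ℝ) :
    Matrix (Fin m) ((Fin n ⊕ Fin p) ⊕ Fin ℓ) ℝ :=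
  U0 * fromCols (Y1 * P⁻¹) G2

/-- `(x, ξ)` is a solution, on the time interval `I`, of the closed-loop system
`ẋ = f(x) + B 𝒦 𝒵(x, ξ) + E d`, `ξ̇ = h(x) - r`. -/
def IsClosedLoopSolution (f : (Fin n → ℝ) → (Fin n → ℝ)) (h : (Fin n → ℝ) → (Fin p → ℝ))
    (B : Matrix (Fin n) (Fin m) ℝ) (E : Matrix (Fin n) (Fin q) ℝ)
    (Q : (Fin n → ℝ) → (Fin ℓ → ℝ)) (K : Matrix (Fin m) ((Fin n ⊕ Fin p) ⊕ Fin ℓ) ℝ)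
    (d : Fin q → ℝ) (r : Fin p → ℝ) (I : Set ℝ)
    (x : ℝ → (Fin n → ℝ)) (ξ : ℝ → (Fin p → ℝ)) : Prop :=
  ∀ t ∈ I,
    HasDerivWithinAt x (f (x t) + B *ᵥ (K *ᵥ extDictionary Q (x t) (ξ t)) + E *ᵥ d) I t ∧
    HasDerivWithinAt ξ (h (x t) - r) I t

end IntegralControl

end

/-!
The columns of `[Y₁ P⁻¹, G₂]` are weights summing to zero, so taking these combinations of the
samples cancels the disturbance of the experiment: the closed loop becomes
`ẇ = 𝒵₁ Y₁ P⁻¹ w + 𝒵₁ G₂ Q(x) + c` with `w = [x; ξ]`, where only the constant `c = [E d; -r]`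
depends on `d` and `r`. The increments of `Q` are dominated by those of `R_Qᵀ x`, so the linear
matrix inequality makes this vector field strongly dissipative for the inner product `⟪·, P⁻¹ ·⟫`,
whatever `c` is. Being also globally Lipschitz, it has complete trajectories and an equilibrium
which attracts all of them exponentially, and there `ξ̇ = h(x) - r` vanishes.
-/

namespace IntegralControl

open scoped NNReal RealInnerProductSpace

section IntegralCurves

variable {V : Type*} [NormedAddCommGroup V] [NormedSpace ℝ V]

theorem isIntegralCurveOn_of_eqOn {w : ℝ → V → V} {s : Set ℝ} {γ δ : ℝ → V} (h : EqOn δ γ s)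
    (hγ : IsIntegralCurveOn γ w s) : IsIntegralCurveOn δ w s := fun t ht ↦ by
  rw [h ht]
  exact (hγ t ht).congr h (h ht)

theorem isIntegralCurveOn_union {w : ℝ → V → V} {s s' : Set ℝ} {γ : ℝ → V} (hs : IsClosed s)
    (hs' : IsClosed s') (hγ : IsIntegralCurveOn γ w s) (hγ' : IsIntegralCurveOn γ w s') :
    IsIntegralCurveOn γ w (s ∪ s') := by
  have extend {s : Set ℝ} (hs : IsClosed s) (hγ : IsIntegralCurveOn γ w s) (t : ℝ) :
      HasDerivWithinAt γ (w t (γ t)) s t := by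
    by_cases ht : t ∈ s
    · exact hγ t ht
    · exact HasFDerivWithinAt.of_notMem_closure (by rwa [hs.closure_eq])
  exact fun t _ ↦ (extend hs hγ t).union (extend hs' hγ' t)

theorem exists_isIntegralCurveOn_Icc_trans {w : ℝ → V → V} {a b c : ℝ} (hab : a ≤ b) (hbc : b ≤ c)
    {γ δ : ℝ → V} (hγ : IsIntegralCurveOn γ w (Icc a b)) (hδ : IsIntegralCurveOn δ w (Icc b c))
    (hb : γ b = δ b) : ∃ η : ℝ → V, η a = γ a ∧ IsIntegralCurveOn η w (Icc a c) := by
  let η : ℝ → V := fun t ↦ if t ≤ b then γ t else δ t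
  have hηγ : EqOn η γ (Icc a b) := fun t ht ↦ if_pos ht.2
  have hηδ : EqOn η δ (Icc b c) := fun t ht ↦ by
    obtain rfl | hlt := ht.1.eq_or_lt
    · exact (if_pos le_rfl).trans hb
    · exact if_neg hlt.not_ge
  refine ⟨η, hηγ (left_mem_Icc.2 hab), ?_⟩
  rw [← Icc_union_Icc_eq_Icc hab hbc]
  exact isIntegralCurveOn_union isClosed_Icc isClosed_Icc (isIntegralCurveOn_of_eqOn hηγ hγ)
    (isIntegralCurveOn_of_eqOn hηδ hδ)

theorem isIntegralCurveOn_continuousLinearEquiv_comp {W : Type*} [NormedAddCommGroup W]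
    [NormedSpace ℝ W] {v : V → V} {s : Set ℝ} {γ : ℝ → V} (e : V ≃L[ℝ] W)
    (hγ : IsIntegralCurveOn γ (fun _ ↦ v) s) :
    IsIntegralCurveOn (e ∘ γ) (fun _ ↦ e ∘ v ∘ e.symm) s := fun t ht ↦ by
  simpa using e.hasFDerivAt.comp_hasDerivWithinAt t (hγ t ht)

variable {v : V → V} {L : ℝ≥0}

theorem eqOn_of_isIntegralCurveOn (hv : LipschitzWith L v) {I : Set ℝ} (hI : I.OrdConnected)
    {a : ℝ} (ha : IsLeast I a) {γ δ : ℝ → V} (hγ : IsIntegralCurveOn γ (fun _ ↦ v) I)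
    (hδ : IsIntegralCurveOn δ (fun _ ↦ v) I) (h : γ a = δ a) : EqOn γ δ I := by
  intro t ht
  have hsub : Icc a t ⊆ I := hI.out ha.1 ht
  have right_deriv {η : ℝ → V} (hη : IsIntegralCurveOn η (fun _ ↦ v) I) :
      ∀ s ∈ Ico a t, HasDerivWithinAt η (v (η s)) (Ici s) s := fun s hs ↦
    ((hη.mono hsub) s (Ico_subset_Icc_self hs)).mono_of_mem_nhdsWithin
      (mem_of_superset (Icc_mem_nhdsGE hs.2) (Icc_subset_Icc_left hs.1))
  exact ODE_solution_unique (fun _ ↦ hv) (hγ.mono hsub).continuousOn (right_deriv hγ)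
    (hδ.mono hsub).continuousOn (right_deriv hδ) h (right_mem_Icc.2 (ha.2 ht))

variable [CompleteSpace V]

-- On the ball of radius `‖v x‖` around `x` the speed is at most `(L + 1) * ‖v x‖`, whence a
-- lifespan that does not depend on `x`.
theorem exists_isIntegralCurveOn_Icc_one_div (hv : LipschitzWith L v) (a : ℝ) (x : V) :
    ∃ γ : ℝ → V, γ a = x ∧ IsIntegralCurveOn γ (fun _ ↦ v) (Icc a (a + 1 / (L + 1))) := by
  have hspeed : ∀ y ∈ Metric.closedBall x ‖v x‖₊, ‖v y‖ ≤ ((L + 1) * ‖v x‖₊ : ℝ≥0) :=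
    fun y hy ↦ calc
      ‖v y‖ ≤ ‖v y - v x‖ + ‖v x‖ := norm_le_norm_sub_add _ _
      _ ≤ L * ‖y - x‖ + ‖v x‖ := by gcongr; exact hv.norm_sub_le y x
      _ ≤ L * ‖v x‖ + ‖v x‖ := by gcongr; exact mem_closedBall_iff_norm.1 hy
      _ = ((L + 1) * ‖v x‖₊ : ℝ≥0) := by push_cast; ring
  have hpos : (0 : ℝ) < 1 / (L + 1) := by positivity
  have hPL : IsPicardLindelof (fun _ ↦ v) (tmin := a) (tmax := a + 1 / (L + 1))
      ⟨a, left_mem_Icc.2 (by linarith)⟩ x ‖v x‖₊ 0 ((L + 1) * ‖v x‖₊) L := by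
    refine .of_time_independent hspeed hv.lipschitzOnWith (le_of_eq ?_)
    simp only [add_sub_cancel_left, sub_self, max_eq_left hpos.le]
    push_cast
    field_simp
    ring
  exact hPL.exists_eq_forall_mem_Icc_hasDerivWithinAt₀

theorem exists_isIntegralCurveOn_Icc (hv : LipschitzWith L v) (a b : ℝ) (x : V) :
    ∃ γ : ℝ → V, γ a = x ∧ IsIntegralCurveOn γ (fun _ ↦ v) (Icc a b) := by
  have hpos : (0 : ℝ) < 1 / (L + 1) := by positivity
  have hsteps (k : ℕ) : ∃ γ : ℝ → V, γ a = x ∧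
      IsIntegralCurveOn γ (fun _ ↦ v) (Icc a (a + k * (1 / (L + 1)))) := by
    induction k with
    | zero =>
      obtain ⟨γ, hγa, hγ⟩ := exists_isIntegralCurveOn_Icc_one_div hv a x
      exact ⟨γ, hγa, hγ.mono (Icc_subset_Icc_right (by simpa using hpos.le))⟩
    | succ k ih =>
      obtain ⟨γ, hγa, hγ⟩ := ih
      obtain ⟨δ, hδk, hδ⟩ :=
        exists_isIntegralCurveOn_Icc_one_div hv (a + k * (1 / (L + 1))) (γ (a + k * (1 / (L + 1))))
      obtain ⟨η, hηa, hη⟩ := exists_isIntegralCurveOn_Icc_trans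
        (le_add_of_nonneg_right (by positivity)) (le_add_of_nonneg_right hpos.le) hγ hδ hδk.symm
      refine ⟨η, hηa.trans hγa, ?_⟩
      rwa [Nat.cast_succ, add_one_mul, ← add_assoc]
  obtain ⟨k, hk⟩ := Archimedean.arch (b - a) hpos
  obtain ⟨γ, hγa, hγ⟩ := hsteps k
  rw [nsmul_eq_mul] at hk
  exact ⟨γ, hγa, hγ.mono (Icc_subset_Icc_right (by linarith))⟩

theorem exists_isIntegralCurveOn_Ici (hv : LipschitzWith L v) (a : ℝ) (x : V) :
    ∃ γ : ℝ → V, γ a = x ∧ IsIntegralCurveOn γ (fun _ ↦ v) (Ici a) := by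
  choose γ hγa hγ using fun b ↦ exists_isIntegralCurveOn_Icc hv a b x
  have hagree {b t : ℝ} (ht : t ∈ Icc a b) : γ t t = γ b t :=
    eqOn_of_isIntegralCurveOn hv ordConnected_Icc (isLeast_Icc ht.1) (hγ t)
      ((hγ b).mono (Icc_subset_Icc_right ht.2)) ((hγa t).trans (hγa b).symm)
      (right_mem_Icc.2 ht.1)
  refine ⟨fun t ↦ γ t t, hγa a, fun t ht ↦ ?_⟩
  have hIcc : IsIntegralCurveOn (fun t ↦ γ t t) (fun _ ↦ v) (Icc a (t + 1)) :=
    isIntegralCurveOn_of_eqOn (fun s hs ↦ hagree hs) (hγ (t + 1))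
  refine (hIcc t ⟨ht, by linarith⟩).mono_of_mem_nhdsWithin ?_
  rw [← Ici_inter_Iic]
  exact inter_mem_nhdsWithin _ (Iic_mem_nhds (by linarith))

end IntegralCurves

section StrongDissipativity

variable {H : Type*} [NormedAddCommGroup H] [InnerProductSpace ℝ H]

/-- A vector field on an inner product space is strongly dissipative with rate `κ` when its negative
is strongly monotone with modulus `κ`; its flow then contracts distances by the factor
`exp (-κ t)`. -/
def IsStronglyDissipative (κ : ℝ) (v : H → H) : Prop :=
  ∀ x y, ⟪x - y, v x - v y⟫ ≤ -κ * ‖x - y‖ ^ 2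

variable {v : H → H} {κ : ℝ} {L : ℝ≥0}

theorem IsStronglyDissipative.norm_add_smul_sub_sq_le (hd : IsStronglyDissipative κ v)
    (hv : LipschitzWith L v) {ε : ℝ} (hε : 0 ≤ ε) (x y : H) :
    ‖x + ε • v x - (y + ε • v y)‖ ^ 2 ≤ (1 - 2 * ε * κ + ε ^ 2 * L ^ 2) * ‖x - y‖ ^ 2 := calc
  ‖x + ε • v x - (y + ε • v y)‖ ^ 2 = ‖x - y + ε • (v x - v y)‖ ^ 2 := by
    rw [smul_sub, add_sub_add_comm]
  _ = ‖x - y‖ ^ 2 + 2 * ε * ⟪x - y, v x - v y⟫ + ε ^ 2 * ‖v x - v y‖ ^ 2 := by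
    rw [norm_add_sq_real, real_inner_smul_right, norm_smul, Real.norm_of_nonneg hε]
    ring
  _ ≤ ‖x - y‖ ^ 2 + 2 * ε * (-κ * ‖x - y‖ ^ 2) + ε ^ 2 * (L * ‖x - y‖) ^ 2 := by
    gcongr
    · exact hd x y
    · exact hv.norm_sub_le x y
  _ = (1 - 2 * ε * κ + ε ^ 2 * L ^ 2) * ‖x - y‖ ^ 2 := by ring

-- Zeros of `v` are fixed points of `x ↦ x + ε • v x`, a contraction for small `ε > 0`.
theorem IsStronglyDissipative.exists_eq_zero [CompleteSpace H] (hd : IsStronglyDissipative κ v)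
    (hκ : 0 < κ) (hv : LipschitzWith L v) : ∃ z, v z = 0 := by
  let ε : ℝ := κ / (L ^ 2 + 1)
  have hε : 0 < ε := by positivity
  have hεL : ε * (L ^ 2 + 1) = κ := div_mul_cancel₀ _ (by positivity)
  have hlt : 1 - 2 * ε * κ + ε ^ 2 * L ^ 2 < 1 := by nlinarith [mul_pos hε hκ]
  have hcontr : ContractingWith (√(1 - 2 * ε * κ + ε ^ 2 * L ^ 2)).toNNReal
      fun x ↦ x + ε • v x := by
    refine ⟨Real.toNNReal_lt_one.2 ((Real.sqrt_lt' one_pos).2 (by rwa [one_pow])),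
      LipschitzWith.of_dist_le_mul fun x y ↦ ?_⟩
    rw [Real.coe_toNNReal _ (Real.sqrt_nonneg _), dist_eq_norm, dist_eq_norm,
      ← Real.sqrt_sq (norm_nonneg (x - y)), ← Real.sqrt_mul' _ (sq_nonneg _)]
    exact Real.le_sqrt_of_sq_le (hd.norm_add_smul_sub_sq_le hv hε.le x y)
  have : Nonempty H := ⟨0⟩
  have hfix : hcontr.fixedPoint + ε • v hcontr.fixedPoint = hcontr.fixedPoint :=
    hcontr.fixedPoint_isFixedPt
  exact ⟨hcontr.fixedPoint, (smul_eq_zero.1 (add_eq_left.1 hfix)).resolve_left hε.ne'⟩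

theorem IsStronglyDissipative.antitoneOn_exp_mul_norm_sub_sq (hd : IsStronglyDissipative κ v)
    {γ δ : ℝ → H} (hγ : IsIntegralCurveOn γ (fun _ ↦ v) (Ici 0))
    (hδ : IsIntegralCurveOn δ (fun _ ↦ v) (Ici 0)) :
    AntitoneOn (fun t ↦ Real.exp (2 * κ * t) * ‖γ t - δ t‖ ^ 2) (Ici 0) := by
  have hexp (t : ℝ) :
      HasDerivAt (fun t ↦ Real.exp (2 * κ * t)) (Real.exp (2 * κ * t) * (2 * κ)) t := by
    simpa using ((hasDerivAt_id t).const_mul (2 * κ)).exp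
  have hderiv (t : ℝ) (ht : t ∈ Ici 0) :=
    (hexp t).hasDerivWithinAt.mul ((hγ t ht).sub (hδ t ht)).norm_sq
  refine antitoneOn_of_hasDerivWithinAt_nonpos (convex_Ici 0)
    (fun t ht ↦ (hderiv t ht).continuousWithinAt)
    (fun t ht ↦ (hderiv t (interior_subset ht)).mono interior_subset) fun t _ ↦ ?_
  calc Real.exp (2 * κ * t) * (2 * κ) * ‖γ t - δ t‖ ^ 2
        + Real.exp (2 * κ * t) * (2 * ⟪γ t - δ t, v (γ t) - v (δ t)⟫)
      ≤ Real.exp (2 * κ * t) * (2 * κ) * ‖γ t - δ t‖ ^ 2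
        + Real.exp (2 * κ * t) * (2 * (-κ * ‖γ t - δ t‖ ^ 2)) := by gcongr; exact hd _ _
    _ = 0 := by ring

theorem IsStronglyDissipative.norm_sub_le_exp_mul (hd : IsStronglyDissipative κ v) {γ δ : ℝ → H}
    (hγ : IsIntegralCurveOn γ (fun _ ↦ v) (Ici 0)) (hδ : IsIntegralCurveOn δ (fun _ ↦ v) (Ici 0))
    {t : ℝ} (ht : 0 ≤ t) : ‖γ t - δ t‖ ≤ Real.exp (-κ * t) * ‖γ 0 - δ 0‖ := by
  have h : (Real.exp (κ * t) * ‖γ t - δ t‖) ^ 2 ≤ ‖γ 0 - δ 0‖ ^ 2 := by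
    have := hd.antitoneOn_exp_mul_norm_sub_sq hγ hδ self_mem_Ici ht ht
    simp only [mul_zero, Real.exp_zero, one_mul] at this
    rwa [mul_pow, ← Real.exp_nat_mul, Nat.cast_ofNat, ← mul_assoc]
  rw [neg_mul, Real.exp_neg, ← div_eq_inv_mul, le_div_iff₀' (Real.exp_pos _)]
  exact le_of_sq_le_sq h (norm_nonneg _)

variable {V : Type*} [NormedAddCommGroup V] [NormedSpace ℝ V]

theorem isBounded_and_tendsto_of_isStronglyDissipative {v : V → V} {e : V ≃L[ℝ] H} (hκ : 0 < κ)
    (hd : IsStronglyDissipative κ (e ∘ v ∘ e.symm)) {z : V} (hz : v z = 0) {γ : ℝ → V}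
    (hγ : IsIntegralCurveOn γ (fun _ ↦ v) (Ici 0)) :
    Bornology.IsBounded (γ '' Ici 0) ∧ Tendsto γ atTop (𝓝 z) := by
  have hconst : IsIntegralCurveOn (fun _ ↦ e z) (fun _ ↦ e ∘ v ∘ e.symm) (Ici 0) := fun t _ ↦ by
    simpa [hz] using hasDerivWithinAt_const t (Ici 0) (e z)
  have hdecay {t : ℝ} (ht : 0 ≤ t) :
      ‖e (γ t) - e z‖ ≤ Real.exp (-κ * t) * ‖e (γ 0) - e z‖ :=
    hd.norm_sub_le_exp_mul (isIntegralCurveOn_continuousLinearEquiv_comp e hγ) hconst ht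
  constructor
  · have hball : (e ∘ γ) '' Ici 0 ⊆ Metric.closedBall (e z) ‖e (γ 0) - e z‖ := by
      rintro _ ⟨t, ht, rfl⟩
      refine mem_closedBall_iff_norm.2 ((hdecay ht).trans ?_)
      exact mul_le_of_le_one_left (norm_nonneg _)
        (Real.exp_le_one_iff.2 (mul_nonpos_of_nonpos_of_nonneg (by linarith) ht))
    rw [← e.symm_image_image (γ '' Ici 0), ← image_comp e]
    exact e.symm.lipschitz.isBounded_image (Metric.isBounded_closedBall.subset hball)
  · have hexp : Tendsto (fun t ↦ Real.exp (-κ * t) * ‖e (γ 0) - e z‖) atTop (𝓝 0) := by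
      have := Real.tendsto_exp_atBot.comp (tendsto_id.const_mul_atTop_of_neg (neg_neg_of_pos hκ))
      simpa using this.mul_const ‖e (γ 0) - e z‖
    have he : Tendsto (fun t ↦ e (γ t)) atTop (𝓝 (e z)) := tendsto_iff_norm_sub_tendsto_zero.2 <|
      tendsto_of_tendsto_of_tendsto_of_le_of_le' tendsto_const_nhds hexp
        (.of_forall fun _ ↦ norm_nonneg _) ((eventually_ge_atTop 0).mono fun _ ↦ hdecay)
    simpa [Function.comp_def] using (e.symm.continuous.tendsto _).comp he

theorem exists_equilibrium_of_isStronglyDissipative [CompleteSpace H] {v : V → V} {e : V ≃L[ℝ] H}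
    (hκ : 0 < κ) (hd : IsStronglyDissipative κ (e ∘ v ∘ e.symm)) (hv : LipschitzWith L v) :
    ∃ z, v z = 0 := by
  obtain ⟨z, hz⟩ := hd.exists_eq_zero hκ (e.lipschitz.comp (hv.comp e.symm.lipschitz))
  exact ⟨e.symm z, e.map_eq_zero_iff.1 hz⟩

end StrongDissipativity

section QuadraticForms

variable {ι σ : Type*} [Fintype ι] [Fintype σ]

theorem norm_toLp_sq_eq_dotProduct (a : ι → ℝ) : ‖WithLp.toLp 2 a‖ ^ 2 = a ⬝ᵥ a := by
  rw [← real_inner_self_eq_norm_sq, EuclideanSpace.inner_toLp_toLp, star_trivial]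

theorem mulVec_dotProduct_mulVec (M : Matrix σ ι ℝ) (a b : ι → ℝ) :
    (M *ᵥ a) ⬝ᵥ (M *ᵥ b) = a ⬝ᵥ (Mᵀ * M) *ᵥ b := by
  rw [← mulVec_mulVec, dotProduct_mulVec a, vecMul_transpose]

theorem exists_dotProduct_mulVec_le (M : Matrix ι ι ℝ) :
    ∃ C > 0, ∀ a : ι → ℝ, a ⬝ᵥ M *ᵥ a ≤ C * (a ⬝ᵥ a) := by
  classical
  let A : EuclideanSpace ℝ ι →L[ℝ] EuclideanSpace ℝ ι := toEuclideanCLM (𝕜 := ℝ) M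
  refine ⟨‖A‖ + 1, by positivity, fun a ↦ ?_⟩
  calc a ⬝ᵥ M *ᵥ a = ⟪WithLp.toLp 2 a, A (WithLp.toLp 2 a)⟫ := by
        rw [inner_toEuclideanCLM]
    _ ≤ ‖WithLp.toLp 2 a‖ * (‖A‖ * ‖WithLp.toLp 2 a‖) :=
        (real_inner_le_norm _ _).trans (by gcongr; exact A.le_opNorm _)
    _ ≤ (‖A‖ + 1) * ‖WithLp.toLp 2 a‖ ^ 2 := by nlinarith [sq_nonneg ‖WithLp.toLp 2 a‖]
    _ = (‖A‖ + 1) * (a ⬝ᵥ a) := by rw [norm_toLp_sq_eq_dotProduct]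

open scoped MatrixOrder Matrix.Norms.L2Operator in
theorem exists_continuousLinearEquiv_inner_eq {M : Matrix ι ι ℝ} (hM : M.PosDef) :
    ∃ e : (ι → ℝ) ≃L[ℝ] EuclideanSpace ℝ ι, ∀ a b, ⟪e a, e b⟫ = a ⬝ᵥ M *ᵥ b := by
  classical
  obtain ⟨S, hS⟩ := CStarAlgebra.nonneg_iff_eq_star_mul_self.mp hM.posSemidef.nonneg
  have hSM : Sᵀ * S = M := by
    rw [hS, star_eq_conjTranspose, conjTranspose_eq_transpose_of_trivial]
  have hSunit : IsUnit S := isUnit_of_mul_isUnit_right (hSM ▸ hM.isUnit)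
  refine ⟨(S.toLinearEquiv' hSunit.invertible).toContinuousLinearEquiv.trans
    (EuclideanSpace.equiv ι ℝ).symm, fun a b ↦ ?_⟩
  calc ⟪WithLp.toLp 2 (S *ᵥ a), WithLp.toLp 2 (S *ᵥ b)⟫ = (S *ᵥ a) ⬝ᵥ (S *ᵥ b) := by
        rw [EuclideanSpace.inner_toLp_toLp, star_trivial, dotProduct_comm]
    _ = a ⬝ᵥ M *ᵥ b := by rw [mulVec_dotProduct_mulVec, hSM]

end QuadraticForms

section Jacobian

variable {Q : (Fin n → ℝ) → (Fin ℓ → ℝ)} {R : Matrix (Fin n) (Fin τ) ℝ}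

theorem jacobian_mulVec (x u : Fin n → ℝ) : jacobian Q x *ᵥ u = fderiv ℝ Q x u :=
  LinearMap.toMatrix'_mulVec _ u

theorem norm_toLp_jacobian_mulVec_le {x : Fin n → ℝ}
    (hR : (R * Rᵀ - (jacobian Q x)ᵀ * jacobian Q x).PosSemidef) (u : Fin n → ℝ) :
    ‖WithLp.toLp 2 (jacobian Q x *ᵥ u)‖ ≤ ‖WithLp.toLp 2 (Rᵀ *ᵥ u)‖ := by
  have h := hR.dotProduct_mulVec_nonneg u
  rw [star_trivial, sub_mulVec, dotProduct_sub, ← mulVec_dotProduct_mulVec] at h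
  refine le_of_sq_le_sq ?_ (norm_nonneg _)
  rw [norm_toLp_sq_eq_dotProduct, norm_toLp_sq_eq_dotProduct, mulVec_dotProduct_mulVec Rᵀ,
    transpose_transpose]
  linarith

theorem norm_toLp_sub_le_of_jacobian_le (hQ : Differentiable ℝ Q)
    (hR : ∀ x, (R * Rᵀ - (jacobian Q x)ᵀ * jacobian Q x).PosSemidef) (x y : Fin n → ℝ) :
    ‖WithLp.toLp 2 (Q x - Q y)‖ ≤ ‖WithLp.toLp 2 (Rᵀ *ᵥ (x - y))‖ := by
  have hline (s : ℝ) : HasDerivAt (fun s : ℝ ↦ y + s • (x - y)) (x - y) s := by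
    simpa using ((hasDerivAt_id s).smul_const (x - y)).const_add y
  have hderiv (s : ℝ) : HasDerivAt (fun s : ℝ ↦ WithLp.toLp 2 (Q (y + s • (x - y))))
      (WithLp.toLp 2 (jacobian Q (y + s • (x - y)) *ᵥ (x - y))) s := by
    rw [jacobian_mulVec]
    exact (EuclideanSpace.equiv (Fin ℓ) ℝ).symm.hasFDerivAt.comp_hasDerivAt s
      ((hQ _).hasFDerivAt.comp_hasDerivAt s (hline s))
  simpa [← WithLp.toLp_sub] using norm_image_sub_le_of_norm_deriv_le_segment_01'
    (fun s _ ↦ (hderiv s).hasDerivWithinAt) fun s _ ↦ norm_toLp_jacobian_mulVec_le (hR _) (x - y)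

theorem exists_lipschitzWith_of_jacobian_le (hQ : Differentiable ℝ Q)
    (hR : ∀ x, (R * Rᵀ - (jacobian Q x)ᵀ * jacobian Q x).PosSemidef) :
    ∃ L : ℝ≥0, LipschitzWith L Q := by
  let φ : (Fin n → ℝ) →L[ℝ] EuclideanSpace ℝ (Fin τ) :=
    (EuclideanSpace.equiv (Fin τ) ℝ).symm.toContinuousLinearMap ∘L
      LinearMap.toContinuousLinearMap Rᵀ.mulVecLin
  refine ⟨‖φ‖₊, .of_dist_le_mul fun x y ↦ ?_⟩
  rw [dist_eq_norm, dist_eq_norm]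
  calc ‖Q x - Q y‖ ≤ ‖WithLp.toLp 2 (Q x - Q y)‖ := by
        simpa using (PiLp.lipschitzWith_ofLp 2 fun _ ↦ ℝ).norm_sub_le (WithLp.toLp 2 (Q x - Q y)) 0
    _ ≤ ‖φ (x - y)‖ := norm_toLp_sub_le_of_jacobian_le hQ hR x y
    _ ≤ ‖φ‖ * ‖x - y‖ := φ.le_opNorm _

theorem dotProduct_sub_le_of_jacobian_le (hQ : Differentiable ℝ Q)
    (hR : ∀ x, (R * Rᵀ - (jacobian Q x)ᵀ * jacobian Q x).PosSemidef) (x y : Fin n → ℝ) :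
    (Q x - Q y) ⬝ᵥ (Q x - Q y) ≤ (Rᵀ *ᵥ (x - y)) ⬝ᵥ (Rᵀ *ᵥ (x - y)) := by
  rw [← norm_toLp_sq_eq_dotProduct, ← norm_toLp_sq_eq_dotProduct]
  gcongr
  exact norm_toLp_sub_le_of_jacobian_le hQ hR x y

end Jacobian

section LureField

variable {ι ν σ : Type*} [Fintype ι] [Fintype ν] [Fintype σ]

/-- The Lur’e vector field `w ↦ F w + G φ(w) + c`, a linear field in feedback with the
nonlinearity `φ` and driven by the constant input `c`. -/
def lureField (F : Matrix ι ι ℝ) (G : Matrix ι ν ℝ) (φ : (ι → ℝ) → (ν → ℝ)) (c w : ι → ℝ) : ι → ℝ :=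
  F *ᵥ w + G *ᵥ φ w + c

variable {φ : (ι → ℝ) → (ν → ℝ)}

theorem exists_lipschitzWith_lureField {L : ℝ≥0} (hφ : LipschitzWith L φ) (F : Matrix ι ι ℝ)
    (G : Matrix ι ν ℝ) (c : ι → ℝ) : ∃ K : ℝ≥0, LipschitzWith K (lureField F G φ c) :=
  ⟨_, ((LinearMap.toContinuousLinearMap F.mulVecLin).lipschitz.add
    ((LinearMap.toContinuousLinearMap G.mulVecLin).lipschitz.comp hφ)).add (.const c)⟩

variable [DecidableEq ι] [DecidableEq ν] [DecidableEq σ]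

-- The test vector `(a, b, Sᵀ a)` eliminates the last block row, as in a Schur complement.
theorem dotProduct_le_of_lmi {X : Matrix ι ι ℝ} {N : Matrix ι ν ℝ} {S : Matrix ι σ ℝ} {α : ℝ}
    (hlmi : (-(fromBlocks (fromBlocks (X + Xᵀ + α • 1) N Nᵀ (-1)) (fromRows S 0) (fromCols Sᵀ 0)
      (-1))).PosSemidef) {a : ι → ℝ} {b : ν → ℝ} (hb : b ⬝ᵥ b ≤ (Sᵀ *ᵥ a) ⬝ᵥ (Sᵀ *ᵥ a)) :
    a ⬝ᵥ (X *ᵥ a + N *ᵥ b) ≤ -(α / 2) * (a ⬝ᵥ a) := by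
  have hq := hlmi.dotProduct_mulVec_nonneg (Sum.elim (Sum.elim a b) (Sᵀ *ᵥ a))
  have hX : a ⬝ᵥ Xᵀ *ᵥ a = a ⬝ᵥ X *ᵥ a := by
    rw [dotProduct_mulVec, vecMul_transpose, dotProduct_comm]
  have hN : b ⬝ᵥ Nᵀ *ᵥ a = a ⬝ᵥ N *ᵥ b := by
    rw [dotProduct_mulVec, vecMul_transpose, dotProduct_comm]
  have hS : a ⬝ᵥ S *ᵥ (Sᵀ *ᵥ a) = (Sᵀ *ᵥ a) ⬝ᵥ (Sᵀ *ᵥ a) := by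
    rw [dotProduct_mulVec, ← mulVec_transpose]
  simp only [star_trivial, neg_mulVec, fromBlocks_mulVec, fromRows_mulVec, fromCols_mulVec_sumElim,
    Sum.elim_comp_inl, Sum.elim_comp_inr, ← Sum.elim_add_add, sumElim_dotProduct_sumElim,
    zero_mulVec, one_mulVec, add_mulVec, smul_mulVec, dotProduct_add, dotProduct_neg,
    dotProduct_smul, smul_eq_mul, add_zero, hX, hN, hS] at hq
  rw [dotProduct_add]
  linarith

theorem exists_isStronglyDissipative_lureField {P X : Matrix ι ι ℝ} {G : Matrix ι ν ℝ}
    {W : Matrix ι σ ℝ} {α : ℝ} (hP : P.PosDef) (hα : 0 < α)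
    (hlmi : (-(fromBlocks (fromBlocks (X + Xᵀ + α • 1) G Gᵀ (-1)) (fromRows (P * W) 0)
      (fromCols (P * W)ᵀ 0) (-1))).PosSemidef)
    (hφ : ∀ w w', (φ w - φ w') ⬝ᵥ (φ w - φ w') ≤ (Wᵀ *ᵥ (w - w')) ⬝ᵥ (Wᵀ *ᵥ (w - w')))
    (c : ι → ℝ) : ∃ (e : (ι → ℝ) ≃L[ℝ] EuclideanSpace ℝ ι) (κ : ℝ), 0 < κ ∧
      IsStronglyDissipative κ (e ∘ lureField (X * P⁻¹) G φ c ∘ e.symm) := by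
  obtain ⟨e, he⟩ := exists_continuousLinearEquiv_inner_eq hP.inv
  obtain ⟨C, hC, hPC⟩ := exists_dotProduct_mulVec_le P
  refine ⟨e, α / 2 / C, by positivity, e.surjective.forall₂.2 fun w w' ↦ ?_⟩
  have hPs : Pᵀ = P := by simpa using hP.isHermitian.eq
  obtain ⟨a, ha⟩ : ∃ a, P *ᵥ a = w - w' :=
    ⟨P⁻¹ *ᵥ (w - w'), by
      rw [mulVec_mulVec, mul_nonsing_inv _ (P.isUnit_iff_isUnit_det.1 hP.isUnit), one_mulVec]⟩
  have hinv (M : Matrix ι ι ℝ) : (M * P⁻¹) *ᵥ (w - w') = M *ᵥ a := by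
    rw [← ha, mulVec_mulVec, nonsing_inv_mul_cancel_right _ _ (P.isUnit_iff_isUnit_det.1 hP.isUnit)]
  have hgram (b : ι → ℝ) : ⟪e (w - w'), e b⟫ = a ⬝ᵥ b := by
    rw [he, dotProduct_mulVec, ← mulVec_transpose, transpose_nonsing_inv, hPs,
      ← Matrix.one_mul P⁻¹, hinv, one_mulVec]
  have hincr : lureField (X * P⁻¹) G φ c w - lureField (X * P⁻¹) G φ c w' =
      X *ᵥ a + G *ᵥ (φ w - φ w') := by
    rw [lureField, lureField, add_sub_add_right_eq_sub, add_sub_add_comm, ← mulVec_sub,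
      ← mulVec_sub, hinv]
  have hle := dotProduct_le_of_lmi hlmi (a := a) (b := φ w - φ w') (by
    simpa only [transpose_mul, hPs, ← mulVec_mulVec, ha] using hφ w w')
  simp only [Function.comp_apply, e.symm_apply_apply, ← map_sub]
  calc ⟪e (w - w'), e (lureField (X * P⁻¹) G φ c w - lureField (X * P⁻¹) G φ c w')⟫
      = a ⬝ᵥ (X *ᵥ a + G *ᵥ (φ w - φ w')) := by rw [hgram, hincr]
    _ ≤ -(α / 2) * (a ⬝ᵥ a) := hle
    _ ≤ -(α / 2 / C) * (a ⬝ᵥ P *ᵥ a) := by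
        rw [neg_mul, neg_mul, neg_le_neg_iff, div_mul_eq_mul_div, div_le_iff₀ hC]
        nlinarith [hPC a]
    _ = -(α / 2 / C) * ‖e (w - w')‖ ^ 2 := by
        rw [← real_inner_self_eq_norm_sq, hgram, ha]

end LureField

section DataRepresentation

variable {f : (Fin n → ℝ) → (Fin n → ℝ)} {h : (Fin n → ℝ) → (Fin p → ℝ)}
  {B : Matrix (Fin n) (Fin m) ℝ} {E : Matrix (Fin n) (Fin q) ℝ} {Q : (Fin n → ℝ) → (Fin ℓ → ℝ)}
  {A : Matrix (Fin n) (Fin n ⊕ Fin ℓ) ℝ} {C : Matrix (Fin p) (Fin n ⊕ Fin ℓ) ℝ}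
  {dₑ : Fin q → ℝ} {rₑ : Fin p → ℝ} {ts : Fin T → ℝ} {xₑ : ℝ → (Fin n → ℝ)}
  {ξₑ : ℝ → (Fin p → ℝ)} {uₑ : ℝ → (Fin m → ℝ)} {yₑ : ℝ → (Fin p → ℝ)}
  {Z0 : Matrix ((Fin n ⊕ Fin p) ⊕ Fin ℓ) (Fin T) ℝ} {Z1 : Matrix (Fin n ⊕ Fin p) (Fin T) ℝ}
  {RQ : Matrix (Fin n) (Fin τ) ℝ} {P : Matrix (Fin n ⊕ Fin p) (Fin n ⊕ Fin p) ℝ}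
  {Y1 : Matrix (Fin T) (Fin n ⊕ Fin p) ℝ} {G2 : Matrix (Fin T) (Fin ℓ) ℝ} {α : ℝ}

theorem of_columns_mulVec {ι κ : Type*} [Fintype κ] (c : κ → ι → ℝ) (g : κ → ℝ) :
    (Matrix.of fun j i ↦ c i j) *ᵥ g = ∑ i, g i • c i :=
  (mulVec_transpose (.of c) g).trans (vecMul_eq_sum g _)

theorem sum_smul_dictionary_of_dataZ0_mulVec {g : Fin T → ℝ} {x : Fin n → ℝ} {ξ : Fin p → ℝ}
    (hg : dataZ0 Q ts xₑ ξₑ *ᵥ g = extDictionary Q x ξ) :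
    ∑ i, g i • dictionary Q (xₑ (ts i)) = dictionary Q x := by
  rw [dataZ0, of_columns_mulVec] at hg
  ext (k | k)
  · simpa [extDictionary, dictionary] using congrFun hg (Sum.inl (Sum.inl k))
  · simpa [extDictionary, dictionary] using congrFun hg (Sum.inr k)

-- Since the weights `g` sum to zero, the disturbance of the experiment cancels.
theorem IsExperiment.dataZ1_mulVec (hf : ∀ x, f x = A *ᵥ dictionary Q x)
    (hh : ∀ x, h x = C *ᵥ dictionary Q x) (hexp : IsExperiment f h B E dₑ rₑ ts xₑ ξₑ uₑ yₑ)
    {g : Fin T → ℝ} (hsum : ∑ i, g i = 0) {x : Fin n → ℝ} {ξ : Fin p → ℝ}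
    (hg : dataZ0 Q ts xₑ ξₑ *ᵥ g = extDictionary Q x ξ) :
    dataZ1 ts xₑ yₑ *ᵥ g = Sum.elim (f x + B *ᵥ (dataU0 ts uₑ *ᵥ g)) (h x) := by
  have hdict := sum_smul_dictionary_of_dataZ0_mulVec hg
  have hderiv (i : Fin T) : derivWithin xₑ (Ici 0) (ts i) =
      A *ᵥ dictionary Q (xₑ (ts i)) + B *ᵥ uₑ (ts i) + E *ᵥ dₑ := by
    rw [← hf]
    exact (hexp.state_eq i).derivWithin (uniqueDiffOn_Ici 0 _ (hexp.times_nonneg i))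
  have hstate : ∑ i, g i • derivWithin xₑ (Ici 0) (ts i) = f x + B *ᵥ (dataU0 ts uₑ *ᵥ g) := by
    simp only [hf x, hderiv, dataU0, of_columns_mulVec, smul_add, Finset.sum_add_distrib,
      ← Finset.sum_smul, ← mulVec_smul, ← mulVec_sum, hdict, hsum, zero_smul, mulVec_zero,
      add_zero]
  have houtput : ∑ i, g i • yₑ (ts i) = h x := by
    simp only [hexp.output_eq, hh, ← mulVec_smul, ← mulVec_sum, hdict]
  rw [dataZ1, of_columns_mulVec, ← hstate, ← houtput]
  ext (k | k) <;> simp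

theorem SDPFeasible.dataZ0_mul (hSDP : SDPFeasible Z0 Z1 RQ P Y1 G2 α) :
    Z0 * fromCols (Y1 * P⁻¹) G2 = 1 := by
  have hPunit := P.isUnit_iff_isUnit_det.1 hSDP.posDef.isUnit
  rw [mul_fromCols, ← Matrix.mul_assoc, hSDP.data_Y1, hSDP.data_G2, fromRows_mul,
    mul_nonsing_inv _ hPunit, Matrix.zero_mul, fromCols_fromRows_eq_fromBlocks, fromBlocks_one]

theorem SDPFeasible.sum_fromCols_mulVec_eq_zero (hSDP : SDPFeasible Z0 Z1 RQ P Y1 G2 α)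
    (z : (Fin n ⊕ Fin p) ⊕ Fin ℓ → ℝ) : ∑ i, (fromCols (Y1 * P⁻¹) G2 *ᵥ z) i = 0 := by
  have hones := hSDP.ones
  rw [mul_fromCols, ← fromCols_zero, fromCols_ext_iff] at hones
  have hsum (v : Fin T → ℝ) :
      ∑ i, v i = ((Matrix.of fun _ _ ↦ 1 : Matrix (Fin 1) (Fin T) ℝ) *ᵥ v) 0 := by
    simp [mulVec, dotProduct]
  have hzero :
      (Matrix.of fun _ _ ↦ 1 : Matrix (Fin 1) (Fin T) ℝ) * fromCols (Y1 * P⁻¹) G2 = 0 := by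
    rw [mul_fromCols, ← Matrix.mul_assoc, hones.1, hones.2, Matrix.zero_mul, fromCols_zero]
  rw [hsum, mulVec_mulVec, hzero, zero_mulVec, Pi.zero_apply]

/-- The vector field of the closed loop, on the stacked state `w = [x; ξ]`. -/
def closedLoopField (f : (Fin n → ℝ) → (Fin n → ℝ)) (h : (Fin n → ℝ) → (Fin p → ℝ))
    (B : Matrix (Fin n) (Fin m) ℝ) (E : Matrix (Fin n) (Fin q) ℝ)
    (Q : (Fin n → ℝ) → (Fin ℓ → ℝ)) (K : Matrix (Fin m) ((Fin n ⊕ Fin p) ⊕ Fin ℓ) ℝ)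
    (d : Fin q → ℝ) (r : Fin p → ℝ) (w : Fin n ⊕ Fin p → ℝ) : Fin n ⊕ Fin p → ℝ :=
  Sum.elim
    (f (w ∘ Sum.inl) + B *ᵥ (K *ᵥ extDictionary Q (w ∘ Sum.inl) (w ∘ Sum.inr)) + E *ᵥ d)
    (h (w ∘ Sum.inl) - r)

theorem closedLoopField_gain_eq_lureField (hf : ∀ x, f x = A *ᵥ dictionary Q x)
    (hh : ∀ x, h x = C *ᵥ dictionary Q x) (hexp : IsExperiment f h B E dₑ rₑ ts xₑ ξₑ uₑ yₑ)
    (hSDP : SDPFeasible (dataZ0 Q ts xₑ ξₑ) (dataZ1 ts xₑ yₑ) RQ P Y1 G2 α)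
    (d : Fin q → ℝ) (r : Fin p → ℝ) :
    closedLoopField f h B E Q (gain (dataU0 ts uₑ) P Y1 G2) d r =
      lureField (dataZ1 ts xₑ yₑ * Y1 * P⁻¹) (dataZ1 ts xₑ yₑ * G2) (fun w ↦ Q (w ∘ Sum.inl))
        (Sum.elim (E *ᵥ d) (-r)) := by
  funext w
  set z := extDictionary Q (w ∘ Sum.inl) (w ∘ Sum.inr) with hz
  set g := fromCols (Y1 * P⁻¹) G2 *ᵥ z with hg
  have hdata := hexp.dataZ1_mulVec hf hh (hSDP.sum_fromCols_mulVec_eq_zero z)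
    (by rw [mulVec_mulVec, hSDP.dataZ0_mul, one_mulVec])
  have hfield : dataZ1 ts xₑ yₑ *ᵥ g =
      (dataZ1 ts xₑ yₑ * Y1 * P⁻¹) *ᵥ w + (dataZ1 ts xₑ yₑ * G2) *ᵥ Q (w ∘ Sum.inl) := by
    rw [hg, mulVec_mulVec, mul_fromCols, hz, extDictionary, fromCols_mulVec_sumElim,
      Sum.elim_comp_inl_inr, ← Matrix.mul_assoc]
  rw [lureField, ← hfield, hdata, closedLoopField, gain, ← mulVec_mulVec, ← hz, ← hg,
    sub_eq_add_neg, Sum.elim_add_add]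

theorem exists_lipschitzWith_lureField_comp_inl (hQ : Differentiable ℝ Q)
    (hRQ : ∀ x, (RQ * RQᵀ - (jacobian Q x)ᵀ * jacobian Q x).PosSemidef)
    (F : Matrix (Fin n ⊕ Fin p) (Fin n ⊕ Fin p) ℝ) (G : Matrix (Fin n ⊕ Fin p) (Fin ℓ) ℝ)
    (c : Fin n ⊕ Fin p → ℝ) :
    ∃ L : ℝ≥0, LipschitzWith L (lureField F G (fun w ↦ Q (w ∘ Sum.inl)) c) := by
  obtain ⟨L, hL⟩ := exists_lipschitzWith_of_jacobian_le hQ hRQ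
  have hinl : LipschitzWith 1 fun w : Fin n ⊕ Fin p → ℝ ↦ w ∘ Sum.inl :=
    .of_dist_le_mul fun w w' ↦ by
      rw [dist_eq_norm, dist_eq_norm, NNReal.coe_one, one_mul]
      exact pi_norm_comp_le (w - w') Sum.inl
  exact exists_lipschitzWith_lureField (hL.comp hinl) F G c

theorem SDPFeasible.exists_isStronglyDissipative (hSDP : SDPFeasible Z0 Z1 RQ P Y1 G2 α)
    (hQ : Differentiable ℝ Q)
    (hRQ : ∀ x, (RQ * RQᵀ - (jacobian Q x)ᵀ * jacobian Q x).PosSemidef)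
    (c : Fin n ⊕ Fin p → ℝ) :
    ∃ (e : (Fin n ⊕ Fin p → ℝ) ≃L[ℝ] EuclideanSpace ℝ (Fin n ⊕ Fin p)) (κ : ℝ), 0 < κ ∧
      IsStronglyDissipative κ
        (e ∘ lureField (Z1 * Y1 * P⁻¹) (Z1 * G2) (fun w ↦ Q (w ∘ Sum.inl)) c ∘ e.symm) := by
  have hPs : Pᵀ = P := by simpa using hSDP.posDef.isHermitian.eq
  have hW (w : Fin n ⊕ Fin p → ℝ) :
      (fromRows RQ (0 : Matrix (Fin p) (Fin τ) ℝ))ᵀ *ᵥ w = RQᵀ *ᵥ (w ∘ Sum.inl) := by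
    rw [transpose_fromRows, transpose_zero, fromCols_mulVec, zero_mulVec, add_zero]
  refine exists_isStronglyDissipative_lureField (W := fromRows RQ 0) hSDP.posDef hSDP.alpha_pos ?_
    (fun w w' ↦ ?_) c
  · rw [transpose_mul Z1 G2, transpose_mul P, hPs]
    exact hSDP.lmi
  · rw [hW]
    exact dotProduct_sub_le_of_jacobian_le hQ hRQ _ _

end DataRepresentation

section ClosedLoop

variable {f : (Fin n → ℝ) → (Fin n → ℝ)} {h : (Fin n → ℝ) → (Fin p → ℝ)}
  {B : Matrix (Fin n) (Fin m) ℝ} {E : Matrix (Fin n) (Fin q) ℝ} {Q : (Fin n → ℝ) → (Fin ℓ → ℝ)}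
  {K : Matrix (Fin m) ((Fin n ⊕ Fin p) ⊕ Fin ℓ) ℝ} {d : Fin q → ℝ} {r : Fin p → ℝ} {I : Set ℝ}
  {x : ℝ → (Fin n → ℝ)} {ξ : ℝ → (Fin p → ℝ)} {L : ℝ≥0}

theorem isClosedLoopSolution_iff_isIntegralCurveOn :
    IsClosedLoopSolution f h B E Q K d r I x ξ ↔ IsIntegralCurveOn
      (fun t ↦ Sum.elim (x t) (ξ t)) (fun _ ↦ closedLoopField f h B E Q K d r) I := by
  refine forall₂_congr fun t _ ↦ ?_
  rw [hasDerivWithinAt_pi, hasDerivWithinAt_pi, hasDerivWithinAt_pi, Sum.forall]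
  rfl

theorem IsClosedLoopSolution.mono {J : Set ℝ} (hsol : IsClosedLoopSolution f h B E Q K d r I x ξ)
    (hJI : J ⊆ I) : IsClosedLoopSolution f h B E Q K d r J x ξ :=
  fun t ht ↦ ⟨(hsol t (hJI ht)).1.mono hJI, (hsol t (hJI ht)).2.mono hJI⟩

theorem exists_isClosedLoopSolution_Ici
    (hv : LipschitzWith L (closedLoopField f h B E Q K d r)) (x₀ : Fin n → ℝ) (ξ₀ : Fin p → ℝ) :
    ∃ (x : ℝ → (Fin n → ℝ)) (ξ : ℝ → (Fin p → ℝ)), x 0 = x₀ ∧ ξ 0 = ξ₀ ∧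
      IsClosedLoopSolution f h B E Q K d r (Ici 0) x ξ := by
  obtain ⟨γ, hγ0, hγ⟩ := exists_isIntegralCurveOn_Ici hv 0 (Sum.elim x₀ ξ₀)
  refine ⟨fun t ↦ γ t ∘ Sum.inl, fun t ↦ γ t ∘ Sum.inr, by simp [hγ0], by simp [hγ0],
    isClosedLoopSolution_iff_isIntegralCurveOn.2 ?_⟩
  simpa only [Sum.elim_comp_inl_inr] using hγ

theorem eqOn_of_isClosedLoopSolution (hv : LipschitzWith L (closedLoopField f h B E Q K d r))
    (hI : I.OrdConnected) {a : ℝ} (ha : IsLeast I a) {x' : ℝ → (Fin n → ℝ)}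
    {ξ' : ℝ → (Fin p → ℝ)} (hsol : IsClosedLoopSolution f h B E Q K d r I x ξ)
    (hsol' : IsClosedLoopSolution f h B E Q K d r I x' ξ') (hx : x a = x' a) (hξ : ξ a = ξ' a) :
    EqOn x x' I ∧ EqOn ξ ξ' I := by
  have heq := eqOn_of_isIntegralCurveOn hv hI ha
    (isClosedLoopSolution_iff_isIntegralCurveOn.1 hsol)
    (isClosedLoopSolution_iff_isIntegralCurveOn.1 hsol') (by simp only [hx, hξ])
  exact ⟨fun t ht ↦ congrArg (· ∘ Sum.inl) (heq ht), fun t ht ↦ congrArg (· ∘ Sum.inr) (heq ht)⟩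

-- At an equilibrium the integrator block `h(x) - r` of the closed-loop field vanishes.
theorem isBounded_and_tendsto_of_isClosedLoopSolution {H : Type*} [NormedAddCommGroup H]
    [InnerProductSpace ℝ H] [CompleteSpace H]
    (hv : LipschitzWith L (closedLoopField f h B E Q K d r))
    {e : (Fin n ⊕ Fin p → ℝ) ≃L[ℝ] H} {κ : ℝ} (hκ : 0 < κ)
    (hd : IsStronglyDissipative κ (e ∘ closedLoopField f h B E Q K d r ∘ e.symm))
    (hsol : IsClosedLoopSolution f h B E Q K d r (Ici 0) x ξ) :
    (∃ M : ℝ, ∀ t : ℝ, 0 ≤ t → ‖x t‖ ≤ M ∧ ‖ξ t‖ ≤ M) ∧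
      Tendsto (fun t ↦ h (x t) - r) atTop (𝓝 0) := by
  obtain ⟨z, hz⟩ := exists_equilibrium_of_isStronglyDissipative hκ hd hv
  obtain ⟨hbdd, hlim⟩ := isBounded_and_tendsto_of_isStronglyDissipative hκ hd hz
    (isClosedLoopSolution_iff_isIntegralCurveOn.1 hsol)
  obtain ⟨M, hM⟩ := hbdd.exists_norm_le
  refine ⟨⟨M, fun t ht ↦ ?_⟩, ?_⟩
  · have hMt := hM _ (mem_image_of_mem _ ht)
    exact ⟨(pi_norm_comp_le (Sum.elim (x t) (ξ t)) Sum.inl).trans hMt,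
      (pi_norm_comp_le (Sum.elim (x t) (ξ t)) Sum.inr).trans hMt⟩
  · have herr : Continuous fun w ↦ closedLoopField f h B E Q K d r w ∘ Sum.inr :=
      (Pi.continuous_precomp _).comp hv.continuous
    have := (herr.tendsto z).comp hlim
    rwa [hz] at this

end ClosedLoop

end IntegralControl


open IntegralControl in
theorem corollary4_general {n p m q ℓ τ T : ℕ}
    (f : (Fin n → ℝ) → (Fin n → ℝ)) (h : (Fin n → ℝ) → (Fin p → ℝ))
    (B : Matrix (Fin n) (Fin m) ℝ) (E : Matrix (Fin n) (Fin q) ℝ)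
    (Q : (Fin n → ℝ) → (Fin ℓ → ℝ)) (hQ : Differentiable ℝ Q)
    (A : Matrix (Fin n) (Fin n ⊕ Fin ℓ) ℝ) (C : Matrix (Fin p) (Fin n ⊕ Fin ℓ) ℝ)
    (hf : ∀ x, f x = A *ᵥ dictionary Q x)
    (hh : ∀ x, h x = C *ᵥ dictionary Q x)
    (RQ : Matrix (Fin n) (Fin τ) ℝ)
    (hRQ : ∀ x, (RQ * RQᵀ - (jacobian Q x)ᵀ * jacobian Q x).PosSemidef)
    (dₑ : Fin q → ℝ) (rₑ : Fin p → ℝ) (ts : Fin T → ℝ)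
    (xₑ : ℝ → (Fin n → ℝ)) (ξₑ : ℝ → (Fin p → ℝ))
    (uₑ : ℝ → (Fin m → ℝ)) (yₑ : ℝ → (Fin p → ℝ))
    (hexp : IsExperiment f h B E dₑ rₑ ts xₑ ξₑ uₑ yₑ)
    (P : Matrix (Fin n ⊕ Fin p) (Fin n ⊕ Fin p) ℝ)
    (Y1 : Matrix (Fin T) (Fin n ⊕ Fin p) ℝ) (G2 : Matrix (Fin T) (Fin ℓ) ℝ) (α : ℝ)
    (hSDP : SDPFeasible (dataZ0 Q ts xₑ ξₑ) (dataZ1 ts xₑ yₑ) RQ P Y1 G2 α)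
    (K : Matrix (Fin m) ((Fin n ⊕ Fin p) ⊕ Fin ℓ) ℝ)
    (hK : K = gain (dataU0 ts uₑ) P Y1 G2)
    (d : Fin q → ℝ) (r : Fin p → ℝ) :
    (∀ (x₀ : Fin n → ℝ) (ξ₀ : Fin p → ℝ),
      ∃ (x : ℝ → (Fin n → ℝ)) (ξ : ℝ → (Fin p → ℝ)),
        x 0 = x₀ ∧ ξ 0 = ξ₀ ∧
        IsClosedLoopSolution f h B E Q K d r (Ici 0) x ξ ∧
        ∀ b : ℝ, 0 < b → ∀ (x' : ℝ → (Fin n → ℝ)) (ξ' : ℝ → (Fin p → ℝ)),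
          x' 0 = x₀ → ξ' 0 = ξ₀ →
          IsClosedLoopSolution f h B E Q K d r (Ico 0 b) x' ξ' →
          EqOn x' x (Ico 0 b) ∧ EqOn ξ' ξ (Ico 0 b)) ∧
    (∀ (x : ℝ → (Fin n → ℝ)) (ξ : ℝ → (Fin p → ℝ)),
      IsClosedLoopSolution f h B E Q K d r (Ici 0) x ξ →
        (∃ M : ℝ, ∀ t : ℝ, 0 ≤ t → ‖x t‖ ≤ M ∧ ‖ξ t‖ ≤ M) ∧
        Tendsto (fun t ↦ h (x t) - r) atTop (𝓝 0)) := by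
  subst hK
  have hfield := closedLoopField_gain_eq_lureField hf hh hexp hSDP d r
  obtain ⟨L, hL⟩ := exists_lipschitzWith_lureField_comp_inl hQ hRQ (dataZ1 ts xₑ yₑ * Y1 * P⁻¹)
    (dataZ1 ts xₑ yₑ * G2) (Sum.elim (E *ᵥ d) (-r))
  obtain ⟨e, κ, hκ, hd⟩ := hSDP.exists_isStronglyDissipative hQ hRQ (Sum.elim (E *ᵥ d) (-r))
  rw [← hfield] at hL hd
  refine ⟨fun x₀ ξ₀ ↦ ?_, fun x ξ ↦ isBounded_and_tendsto_of_isClosedLoopSolution hL hκ hd⟩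
  obtain ⟨x, ξ, hx, hξ, hsol⟩ := exists_isClosedLoopSolution_Ici hL x₀ ξ₀
  refine ⟨x, ξ, hx, hξ, hsol, fun b hb x' ξ' hx' hξ' hsol' ↦ ?_⟩
  exact eqOn_of_isClosedLoopSolution hL ordConnected_Ico (isLeast_Ico hb) hsol'
    (hsol.mono Ico_subset_Ici_self) (hx'.trans hx.symm) (hξ'.trans hξ.symm)

theorem corollary4 {n p m q ℓ τ T : ℕ}
    -- the plant: `ẋ = f(x) + B u + E d`, `y = h(x)`, with `f = A Z`, `h = C Z`, `Z = [x; Q]`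
    (f : (Fin n → ℝ) → (Fin n → ℝ)) (h : (Fin n → ℝ) → (Fin p → ℝ))
    (B : Matrix (Fin n) (Fin m) ℝ) (E : Matrix (Fin n) (Fin q) ℝ)
    (Q : (Fin n → ℝ) → (Fin ℓ → ℝ)) (hQ : ContDiff ℝ 1 Q)
    (A : Matrix (Fin n) (Fin n ⊕ Fin ℓ) ℝ) (C : Matrix (Fin p) (Fin n ⊕ Fin ℓ) ℝ)
    (hf : ∀ x, f x = A *ᵥ IntegralControl.dictionary Q x)
    (hh : ∀ x, h x = C *ᵥ IntegralControl.dictionary Q x)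
    -- the bound on the Jacobian of `Q`, on the whole space
    (RQ : Matrix (Fin n) (Fin τ) ℝ)
    (hRQ : ∀ x, (RQ * RQᵀ -
      (IntegralControl.jacobian Q x)ᵀ * IntegralControl.jacobian Q x).PosSemidef)
    -- the experiment, with its own constant disturbance `dₑ` and reference `rₑ`
    (dₑ : Fin q → ℝ) (rₑ : Fin p → ℝ) (ts : Fin T → ℝ)
    (xₑ : ℝ → (Fin n → ℝ)) (ξₑ : ℝ → (Fin p → ℝ))
    (uₑ : ℝ → (Fin m → ℝ)) (yₑ : ℝ → (Fin p → ℝ))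
    (hexp : IntegralControl.IsExperiment f h B E dₑ rₑ ts xₑ ξₑ uₑ yₑ)
    -- a feasible point of the semidefinite program
    (P : Matrix (Fin n ⊕ Fin p) (Fin n ⊕ Fin p) ℝ)
    (Y1 : Matrix (Fin T) (Fin n ⊕ Fin p) ℝ) (G2 : Matrix (Fin T) (Fin ℓ) ℝ) (α : ℝ)
    (hSDP : IntegralControl.SDPFeasible (IntegralControl.dataZ0 Q ts xₑ ξₑ)
      (IntegralControl.dataZ1 ts xₑ yₑ) RQ P Y1 G2 α)
    -- the resulting controller gain
    (K : Matrix (Fin m) ((Fin n ⊕ Fin p) ⊕ Fin ℓ) ℝ)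
    (hK : K = IntegralControl.gain (IntegralControl.dataU0 ts uₑ) P Y1 G2)
    -- the constant disturbance and reference acting on the closed loop
    (d : Fin q → ℝ) (r : Fin p → ℝ) :
    -- from every initial state there is a solution on `[0, ∞)`, and every solution on some
    -- `[0, b)` from that initial state is a restriction of it
    (∀ (x₀ : Fin n → ℝ) (ξ₀ : Fin p → ℝ),
      ∃ (x : ℝ → (Fin n → ℝ)) (ξ : ℝ → (Fin p → ℝ)),
        x 0 = x₀ ∧ ξ 0 = ξ₀ ∧
        IntegralControl.IsClosedLoopSolution f h B E Q K d r (Ici 0) x ξ ∧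
        ∀ b : ℝ, 0 < b → ∀ (x' : ℝ → (Fin n → ℝ)) (ξ' : ℝ → (Fin p → ℝ)),
          x' 0 = x₀ → ξ' 0 = ξ₀ →
          IntegralControl.IsClosedLoopSolution f h B E Q K d r (Ico 0 b) x' ξ' →
          EqOn x' x (Ico 0 b) ∧ EqOn ξ' ξ (Ico 0 b)) ∧
    -- every solution on `[0, ∞)` is bounded and its tracking error tends to zero
    (∀ (x : ℝ → (Fin n → ℝ)) (ξ : ℝ → (Fin p → ℝ)),
      IntegralControl.IsClosedLoopSolution f h B E Q K d r (Ici 0) x ξ →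
        (∃ M : ℝ, ∀ t : ℝ, 0 ≤ t → ‖x t‖ ≤ M ∧ ‖ξ t‖ ≤ M) ∧
        Tendsto (fun t => h (x t) - r) atTop (𝓝 0)) :=
  corollary4_general f h B E Q (hQ.differentiable one_ne_zero) A C hf hh RQ hRQ dₑ rₑ ts xₑ ξₑ uₑ yₑ
    hexp P Y1 G2 α hSDP K hK d r
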